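/- Theorem 5.3 (Congruence of the incircles of orthic triangles in a Poncelet family). All triangles are nondegenerate, and the orthic triangle of a triangle is the triangle formed by the feet of its altitudes (a right triangle has none). A triangle is *circumscribed about* an ellipse if each of its three sidelines (the lines carrying its sides) is tangent to the ellipse; circles count as ellipses whose two foci coincide. Let $T_0$ be an acute triangle circumscribed about an ellipse $\mathcal E$ with foci $F_1,F_2$, let $O$ and $R$ be the circumcenter and circumradius of $T_0$, and let $\mathcal P$ be the family of all triangles that have the same circumcircle as $T_0$ and are circumscribed about $\mathcal E$. 1. The following are equivalent: (a) all triangles in $\mathcal P$ have orthic triangles, and the incircles of these orthic triangles are pairwise congruent; (b) the incircles of the orthic triangles of the acute triangles in $\mathcal P$ are pairwise congruent; (c) $O$ is the center of $\mathcal E$ or one of its foci. 2. For every acute $T\in\mathcal P$, with orthocenter $H$, the inradius of the orthic triangle of $T$ is $$r_H=\frac{R^2-|OH|^2}{4R}.$$ 3. If $O=F$ is one of the foci and $F'$ is the other one, then every $T\in\mathcal P$ has orthocenter $F'$ and has an orthic triangle, and the incircle of that orthic triangle is the same circle for all $T\in\mathcal P$: it has center $F'$ and radius $\dfrac{R^2-|FF'|^2}{4R}$.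 -/

import Mathlib

/-- The Euclidean plane. -/
abbrev Plane : Type := EuclideanSpace ℝ (Fin 2)

/-- An ellipse (circles included), given by its two foci and its semi-major axis `a`;
nondegeneracy is the condition `|F₁F₂| < 2a`. -/
structure Ellipse where
  focus₁ : Plane
  focus₂ : Plane
  semiMajor : ℝ
  dist_lt : dist focus₁ focus₂ < 2 * semiMajor

namespace Ellipse

/-- The ellipse as a curve: the points whose distances to the foci add up to `2a`. -/
def curve (E : Ellipse) : Set Plane :=
  {X | dist X E.focus₁ + dist X E.focus₂ = 2 * E.semiMajor}

/-- The center of an ellipse. -/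
noncomputable def center (E : Ellipse) : Plane := midpoint ℝ E.focus₁ E.focus₂

/-- A line is tangent to an ellipse iff it meets the ellipse in exactly one point. -/
def IsTangentLine (E : Ellipse) (l : AffineSubspace ℝ Plane) : Prop :=
  ∃! X : Plane, X ∈ l ∧ X ∈ E.curve

/-- A triangle is circumscribed about an ellipse if its three sidelines are tangent to it. -/
def CircumscribedBy (E : Ellipse) (T : Affine.Triangle ℝ Plane) : Prop :=
  ∀ i j : Fin 3, i ≠ j → E.IsTangentLine (affineSpan ℝ {T.points i, T.points j})

/-- The family of all triangles that share the circumcircle of `T₀` and are circumscribed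
about the ellipse. -/
def ponceletFamily (E : Ellipse) (T₀ : Affine.Triangle ℝ Plane) :
    Set (Affine.Triangle ℝ Plane) :=
  {T | T.circumsphere = T₀.circumsphere ∧ E.CircumscribedBy T}

end Ellipse

/-- `N` is the orthic triangle of `T`: its vertices are the feet of the altitudes of `T`.
(A triangle is nondegenerate, so a right triangle has no orthic triangle.) -/
def IsOrthicTriangle (T N : Affine.Triangle ℝ Plane) : Prop :=
  ∀ i : Fin 3, N.points i = T.altitudeFoot i

/-- All triangles of the family have an orthic triangle, and the incircles of these orthic
triangles are congruent to each other (that is, they have the same radius). -/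
def OrthicIncirclesCongruent (Fam : Set (Affine.Triangle ℝ Plane)) : Prop :=
  ∀ T₁ ∈ Fam, ∀ T₂ ∈ Fam, ∃ N₁ N₂ : Affine.Triangle ℝ Plane,
    IsOrthicTriangle T₁ N₁ ∧ IsOrthicTriangle T₂ N₂ ∧ N₁.inradius = N₂.inradius

open ComplexConjugate

/-! Take the common circumcircle as the unit circle of `ℂ`, with vertices `a`, `b`, `c` and foci
`f`, `g`. A line is tangent to an ellipse exactly when the product of the signed distances from the
foci to it is the squared semi-minor axis. For the three chords of an inscribed triangle this
amounts to `a + b + c = f + g + conj f * conj g * (a * b * c)` together with a condition on the foci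
and the semi-minor axis alone (`chordTangent_iff_isogonalFoci`). The left side is the orthocenter
`H`, and `a * b * c` has modulus one, so over the family `H` stays on the circle with center `f + g`
and radius `‖f‖ * ‖g‖`.

The orthic triangle of an acute triangle has incenter `H` and inradius `R (1 - ‖H‖²) / 4`, so
congruence of the incircles means constancy of `‖H‖`. If `f + g = 0`, `f = 0` or `g = 0`, the
modulus of `H` is visibly constant (`IsogonalFoci.norm_sum`), and since acuteness means `‖H‖ < 1`,
the whole family inherits it from `T₀`. With one focus at the origin, `H` is the other focus.

Conversely, a vertex of `T₀` can be moved slightly along the circle, and the triangle can be closed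
up again within the acute family. Constant `‖H‖` would then make a polynomial in that vertex vanish
at infinitely many points, while its constant coefficient is `(f + g) * (f * g)`
(`exists_isogonalFoci_norm_ne`). -/

theorem conj_eq_inv_of_norm_eq_one {a : ℂ} (ha : ‖a‖ = 1) : conj a = a⁻¹ :=
  (Complex.inv_eq_conj ha).symm

theorem ne_zero_of_norm_eq_one {a : ℂ} (ha : ‖a‖ = 1) : a ≠ 0 := by
  rintro rfl; simp at ha

/-! ### Tangent chords of the unit circle and the relation between vertices and foci -/

/-- The chord condition: the line through the points `a`, `b` of the unit circle has product of
signed distances `κ` to `f` and `g`. -/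
def ChordTangent (f g : ℂ) (κ : ℝ) (a b : ℂ) : Prop :=
  (a + b - f - a * b * conj f) * (a + b - g - a * b * conj g) = 4 * (a * b) * κ

theorem ChordTangent.symm {f g : ℂ} {κ : ℝ} {a b : ℂ} (h : ChordTangent f g κ a b) :
    ChordTangent f g κ b a := by
  unfold ChordTangent at *
  linear_combination h

/-- The relation between the vertices of a triangle inscribed in the unit circle and a pair of
isogonally conjugate points. -/
def IsogonalFoci (f g a b c : ℂ) : Prop :=
  a + b + c = f + g + conj f * conj g * (a * b * c)

/-- Conjugation inverts the vertices, so this is the conjugate of the defining relation multiplied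
by `a * b * c`. -/
theorem IsogonalFoci.sum_mul {f g a b c : ℂ} (ha : ‖a‖ = 1) (hb : ‖b‖ = 1) (hc : ‖c‖ = 1)
    (h : IsogonalFoci f g a b c) :
    a * b + b * c + c * a = f * g + (conj f + conj g) * (a * b * c) := by
  have h' := congrArg conj h
  have ha0 := ne_zero_of_norm_eq_one ha
  have hb0 := ne_zero_of_norm_eq_one hb
  have hc0 := ne_zero_of_norm_eq_one hc
  simp only [map_add, map_mul, conj_eq_inv_of_norm_eq_one ha, conj_eq_inv_of_norm_eq_one hb,
    conj_eq_inv_of_norm_eq_one hc, Complex.conj_conj] at h'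
  field_simp at h'
  linear_combination h'

/-- For a fixed endpoint the chord condition is quadratic in the other one. Subtracting two
conditions that share a vertex and cancelling the difference of the other endpoints lowers the
degree; a second such subtraction isolates `κ`. -/
theorem IsogonalFoci.of_chordTangent {f g a b c : ℂ} {κ : ℝ}
    (hab : a ≠ b) (hbc : b ≠ c) (hca : c ≠ a)
    (h₁ : ChordTangent f g κ a b) (h₂ : ChordTangent f g κ b c) (h₃ : ChordTangent f g κ c a) :
    IsogonalFoci f g a b c ∧
      4 * (κ : ℂ) = f * conj g + conj f * g + 1 + (a * b + b * c + c * a) * (conj f * conj g)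
        - (a + b + c) * (conj f + conj g) := by
  unfold ChordTangent at *
  have e₁ : a * (f * conj g + conj f * g - 4 * κ) + a ^ 2 * (b + c) * (conj f * conj g) - (f + g)
      - a * (a + b + c) * (conj f + conj g) + a + (a + b + c) = 0 := by
    apply mul_left_cancel₀ (sub_ne_zero.2 hbc)
    linear_combination h₁ - h₃
  have e₂ : b * (f * conj g + conj f * g - 4 * κ) + b ^ 2 * (a + c) * (conj f * conj g) - (f + g)
      - b * (a + b + c) * (conj f + conj g) + b + (a + b + c) = 0 := by
    apply mul_left_cancel₀ (sub_ne_zero.2 hca)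
    linear_combination h₂ - h₁
  have e₃ : (f * conj g + conj f * g - 4 * κ) + 1 + (a * b + b * c + c * a) * (conj f * conj g)
        - (a + b + c) * (conj f + conj g) = 0 := by
    apply mul_left_cancel₀ (sub_ne_zero.2 hab)
    linear_combination e₁ - e₂
  constructor
  · unfold IsogonalFoci
    linear_combination e₁ - a * e₃
  · linear_combination -e₃

theorem IsogonalFoci.chordTangent {f g a b c : ℂ} {κ : ℝ}
    (ha : ‖a‖ = 1) (hb : ‖b‖ = 1) (hc : ‖c‖ = 1)
    (h : IsogonalFoci f g a b c)
    (hκ : 4 * (κ : ℂ) = (1 - f * conj f) * (1 - g * conj g)) :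
    ChordTangent f g κ a b := by
  have h' := h.sum_mul ha hb hc
  unfold IsogonalFoci at h
  unfold ChordTangent
  linear_combination (-(a * b)) * hκ +
    (a + b - a * b * (conj f + conj g)) * h + (a * b * conj f * conj g - 1) * h'

/-- The condition on `κ` does not involve the vertices. Once one triangle satisfies it, membership
in the family is governed by the isogonal relation alone. -/
theorem chordTangent_iff_isogonalFoci {f g a b c : ℂ} {κ : ℝ}
    (ha : ‖a‖ = 1) (hb : ‖b‖ = 1) (hc : ‖c‖ = 1) (hab : a ≠ b) (hbc : b ≠ c) (hca : c ≠ a) :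
    (ChordTangent f g κ a b ∧ ChordTangent f g κ b c ∧ ChordTangent f g κ c a) ↔
      IsogonalFoci f g a b c ∧ 4 * (κ : ℂ) = (1 - f * conj f) * (1 - g * conj g) := by
  constructor
  · rintro ⟨h₁, h₂, h₃⟩
    obtain ⟨h, hκ⟩ := IsogonalFoci.of_chordTangent hab hbc hca h₁ h₂ h₃
    refine ⟨h, ?_⟩
    have h' := h.sum_mul ha hb hc
    unfold IsogonalFoci at h
    linear_combination hκ + conj f * conj g * h' - (conj f + conj g) * h
  · rintro ⟨h, hκ⟩
    refine ⟨h.chordTangent ha hb hc hκ, ?_, ?_⟩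
    · refine IsogonalFoci.chordTangent (c := a) hb hc ha ?_ hκ
      unfold IsogonalFoci at *; linear_combination h
    · refine IsogonalFoci.chordTangent (c := b) hc ha hb ?_ hκ
      unfold IsogonalFoci at *; linear_combination h

/-! ### Closing up a triangle from one vertex -/

/-- The chord of the unit circle with prescribed sum and product of its endpoints. -/
theorem exists_chord_of_sum_of_prod {s p : ℂ} (hp : ‖p‖ = 1) (hs : ‖s‖ < 2)
    (hsp : p * conj s = s) :
    ∃ b c : ℂ, ‖b‖ = 1 ∧ ‖c‖ = 1 ∧ b ≠ c ∧ b + c = s ∧ b * c = p := by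
  -- Dividing by a square root `q` of `p` makes the sum real: the endpoints are `q` times a
  -- conjugate pair of unit numbers with sum `τ`, distinct because `|τ| < 2`.
  obtain ⟨q, hq⟩ := IsAlgClosed.exists_pow_nat_eq p (n := 2) (by norm_num)
  have hq1 : ‖q‖ = 1 := by
    have : ‖q‖ ^ 2 = 1 := by rw [← norm_pow, hq, hp]
    nlinarith [norm_nonneg q]
  have hq0 := ne_zero_of_norm_eq_one hq1
  obtain ⟨τ, hτ⟩ : ∃ τ : ℝ, s = q * τ := by
    have : conj (s / q) = s / q := by
      rw [map_div₀, conj_eq_inv_of_norm_eq_one hq1]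
      field_simp
      linear_combination hsp + conj s * hq
    obtain ⟨τ, hτ⟩ := Complex.conj_eq_iff_real.1 this
    exact ⟨τ, by rw [← hτ]; field_simp⟩
  have hτ2 : τ ^ 2 < 4 := by
    have : ‖s‖ = |τ| := by rw [hτ, norm_mul, hq1, one_mul, Complex.norm_real, Real.norm_eq_abs]
    rw [this] at hs
    nlinarith [sq_abs τ, abs_nonneg τ]
  obtain ⟨m, hm0, hm⟩ : ∃ m : ℝ, m ≠ 0 ∧ m ^ 2 = 4 - τ ^ 2 :=
    ⟨√(4 - τ ^ 2), (Real.sqrt_pos.2 (by linarith)).ne', Real.sq_sqrt (by linarith)⟩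
  have key : ∀ m : ℝ, m ^ 2 = 4 - τ ^ 2 → ‖q * ((τ + m * Complex.I) / 2)‖ = 1 := by
    intro m hm
    rw [norm_mul, hq1, one_mul, norm_div, Complex.norm_add_mul_I, show τ ^ 2 + m ^ 2 = 2 ^ 2 by linarith,
      Real.sqrt_sq (by norm_num)]
    norm_num
  have hmc : (m : ℂ) ^ 2 = 4 - (τ : ℂ) ^ 2 := by exact_mod_cast congrArg Complex.ofReal hm
  refine ⟨q * ((τ + m * Complex.I) / 2), q * ((τ + (-m : ℝ) * Complex.I) / 2), key m hm,
    key (-m) (by linarith [neg_sq m]), ?_, ?_, ?_⟩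
  · intro h
    have h1 := mul_left_cancel₀ hq0 h
    have : (m : ℂ) * Complex.I = 0 := by push_cast at h1; linear_combination h1
    simp [hm0] at this
  · rw [hτ]; push_cast; ring
  · rw [← hq]; push_cast
    linear_combination (q ^ 2 / 4) * hmc - (q ^ 2 * m ^ 2 / 4) * Complex.I_sq

/-- The product of the other two vertices of the inscribed triangle with isogonally conjugate
points `f`, `g` and a vertex at `a`. -/
noncomputable def oppositeProd (f g a : ℂ) : ℂ :=
  (a - f) * (a - g) / ((1 - a * conj f) * (1 - a * conj g))

/-- The sum of the other two vertices of the inscribed triangle with isogonally conjugate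
points `f`, `g` and a vertex at `a`. -/
noncomputable def oppositeSum (f g a : ℂ) : ℂ :=
  f + g - a + conj f * conj g * (a * oppositeProd f g a)

theorem sub_ne_zero_of_norm_ne_one {f a : ℂ} (hf : ‖f‖ ≠ 1) (ha : ‖a‖ = 1) : a - f ≠ 0 := by
  intro h
  rw [sub_eq_zero] at h
  exact hf (h ▸ ha)

theorem conj_one_sub_mul_conj {f a : ℂ} (ha : ‖a‖ = 1) :
    conj (1 - a * conj f) = a⁻¹ * (a - f) := by
  have ha0 := ne_zero_of_norm_eq_one ha
  simp only [map_sub, map_one, map_mul, conj_eq_inv_of_norm_eq_one ha, Complex.conj_conj]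
  field_simp

theorem norm_one_sub_mul_conj {f a : ℂ} (ha : ‖a‖ = 1) : ‖1 - a * conj f‖ = ‖a - f‖ := by
  rw [← Complex.norm_conj, conj_one_sub_mul_conj ha, norm_mul, norm_inv, ha, inv_one, one_mul]

theorem one_sub_mul_conj_ne_zero {f a : ℂ} (hf : ‖f‖ ≠ 1) (ha : ‖a‖ = 1) :
    1 - a * conj f ≠ 0 := by
  rw [← norm_ne_zero_iff, norm_one_sub_mul_conj ha, norm_ne_zero_iff]
  exact sub_ne_zero_of_norm_ne_one hf ha

section

variable {f g a : ℂ} (hf : ‖f‖ ≠ 1) (hg : ‖g‖ ≠ 1) (ha : ‖a‖ = 1)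

include hf hg ha

theorem oppositeProd_mul :
    oppositeProd f g a * ((1 - a * conj f) * (1 - a * conj g)) = (a - f) * (a - g) :=
  div_mul_cancel₀ _
    (mul_ne_zero (one_sub_mul_conj_ne_zero hf ha) (one_sub_mul_conj_ne_zero hg ha))

theorem norm_oppositeProd : ‖oppositeProd f g a‖ = 1 := by
  rw [oppositeProd, norm_div, norm_mul, norm_mul, norm_one_sub_mul_conj ha,
    norm_one_sub_mul_conj ha, div_self]
  exact mul_ne_zero (norm_ne_zero_iff.2 (sub_ne_zero_of_norm_ne_one hf ha))
    (norm_ne_zero_iff.2 (sub_ne_zero_of_norm_ne_one hg ha))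

/-- This is the symmetry required by `exists_chord_of_sum_of_prod`: the quadratic with this sum and
product is invariant under reflection of its roots in the unit circle. -/
theorem oppositeProd_mul_conj_oppositeSum :
    oppositeProd f g a * conj (oppositeSum f g a) = oppositeSum f g a := by
  have ha0 := ne_zero_of_norm_eq_one ha
  have hp := norm_oppositeProd hf hg ha
  have hp0 := ne_zero_of_norm_eq_one hp
  have h := oppositeProd_mul hf hg ha
  simp only [oppositeSum, map_add, map_sub, map_mul, Complex.conj_conj,
    conj_eq_inv_of_norm_eq_one ha, conj_eq_inv_of_norm_eq_one hp]
  field_simp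
  linear_combination -h

theorem continuousAt_oppositeProd : ContinuousAt (oppositeProd f g) a := by
  refine ContinuousAt.div (by fun_prop) (by fun_prop) ?_
  exact mul_ne_zero (one_sub_mul_conj_ne_zero hf ha) (one_sub_mul_conj_ne_zero hg ha)

theorem continuousAt_oppositeSum : ContinuousAt (oppositeSum f g) a := by
  have := continuousAt_oppositeProd hf hg ha
  unfold oppositeSum
  fun_prop

theorem IsogonalFoci.mul_eq_oppositeProd {b c : ℂ} (hb : ‖b‖ = 1) (hc : ‖c‖ = 1)
    (h : IsogonalFoci f g a b c) : b * c = oppositeProd f g a := by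
  rw [oppositeProd, eq_div_iff (mul_ne_zero (one_sub_mul_conj_ne_zero hf ha)
    (one_sub_mul_conj_ne_zero hg ha))]
  have h' := h.sum_mul ha hb hc
  unfold IsogonalFoci at h
  linear_combination h' - a * h

theorem IsogonalFoci.add_eq_oppositeSum {b c : ℂ} (hb : ‖b‖ = 1) (hc : ‖c‖ = 1)
    (h : IsogonalFoci f g a b c) : b + c = oppositeSum f g a := by
  have hp := h.mul_eq_oppositeProd hf hg ha hb hc
  unfold IsogonalFoci at h
  unfold oppositeSum
  rw [← hp]
  linear_combination h

theorem exists_isogonalFoci_of_vertex (hs : ‖oppositeSum f g a‖ < 2)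
    (hd : a ^ 2 - oppositeSum f g a * a + oppositeProd f g a ≠ 0) :
    ∃ b c : ℂ, ‖b‖ = 1 ∧ ‖c‖ = 1 ∧ a ≠ b ∧ b ≠ c ∧ c ≠ a ∧ IsogonalFoci f g a b c ∧
      a + b + c = a + oppositeSum f g a := by
  obtain ⟨b, c, hb, hc, hbc, hsum, hprod⟩ := exists_chord_of_sum_of_prod
    (norm_oppositeProd hf hg ha) hs (oppositeProd_mul_conj_oppositeSum hf hg ha)
  refine ⟨b, c, hb, hc, ?_, hbc, ?_, ?_, by rw [← hsum]; ring⟩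
  · rintro rfl
    apply hd
    rw [← hsum, ← hprod]
    ring
  · rintro rfl
    apply hd
    rw [← hsum, ← hprod]
    ring
  · have h2 : b + c = f + g - a + conj f * conj g * (a * oppositeProd f g a) := hsum
    rw [← hprod] at h2
    unfold IsogonalFoci
    linear_combination h2

/-- With `l` the product of the three vertices, `‖H‖²` is a Laurent polynomial in `l` because `conj
l = l⁻¹`. Substituting `l = N / D` and clearing denominators leaves a polynomial identity in `a`
without `conj a`, apart from the norm term. -/
theorem add_oppositeSum_normSq_mul :
    let N := a * (a - f) * (a - g)
    let D := (1 - a * conj f) * (1 - a * conj g)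
    let w := (conj f + conj g) * (conj f * conj g)
    w * N ^ 2 + ((f + g) * (conj f + conj g) + f * g * (conj f * conj g)
      - (‖a + oppositeSum f g a‖ : ℂ) ^ 2) * (N * D) + conj w * D ^ 2 = 0 := by
  intro N D w
  have hp := norm_oppositeProd hf hg ha
  have hl : ‖a * oppositeProd f g a‖ = 1 := by rw [norm_mul, ha, hp, one_mul]
  have h := oppositeProd_mul hf hg ha
  set l := a * oppositeProd f g a with hl_def
  have hl0 := ne_zero_of_norm_eq_one hl
  have hN : N = l * D := by
    simp only [N, D, hl_def]
    linear_combination -a * h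
  have hS : a + oppositeSum f g a = f + g + conj f * conj g * l := by
    unfold oppositeSum
    ring
  have hn : (‖a + oppositeSum f g a‖ : ℂ) ^ 2 =
      (f + g + conj f * conj g * l) * (conj f + conj g + f * g * l⁻¹) := by
    rw [← Complex.mul_conj', hS]
    simp only [map_add, map_mul, Complex.conj_conj, conj_eq_inv_of_norm_eq_one hl]
  have hw : conj w = (f + g) * (f * g) := by
    simp only [w, map_add, map_mul, Complex.conj_conj]
  rw [hn, hw, hN]
  simp only [w]
  field_simp
  ring

end

/-! ### Non-constancy of the modulus of the orthocenter -/

theorem infinite_unit_of_eventually {a : ℂ} (ha : ‖a‖ = 1) {P : ℂ → Prop}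
    (h : ∀ᶠ z in nhds a, P z) : {z : ℂ | ‖z‖ = 1 ∧ P z}.Infinite := by
  have hc : Filter.Tendsto (fun θ : ℝ => a * (Circle.exp θ : ℂ)) (nhds 0) (nhds a) := by
    have : ContinuousAt (fun θ : ℝ => a * (Circle.exp θ : ℂ)) 0 := by fun_prop
    simpa [ContinuousAt] using this
  -- The bound on `θ` makes `θ ↦ exp (iθ)` injective there.
  have h1 : ∀ᶠ θ : ℝ in nhds 0, P (a * (Circle.exp θ : ℂ)) ∧ θ ∈ Set.Ioo (-1 : ℝ) 1 :=
    (hc.eventually h).and (Ioo_mem_nhds (by norm_num) (by norm_num))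
  have hinf : {θ : ℝ | P (a * (Circle.exp θ : ℂ)) ∧ θ ∈ Set.Ioo (-1 : ℝ) 1}.Infinite :=
    infinite_of_mem_nhds 0 h1
  refine (hinf.image (f := fun θ : ℝ => a * (Circle.exp θ : ℂ)) ?_).mono ?_
  · intro x hx y hy hxy
    have h2 : Circle.exp x = Circle.exp y :=
      Circle.ext (mul_left_cancel₀ (ne_zero_of_norm_eq_one ha) hxy)
    rw [← Circle.arg_exp (x := x) (by linarith [hx.2.1, Real.pi_gt_three])
      (by linarith [hx.2.2, Real.pi_gt_three]), h2, Circle.arg_exp] <;>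
      linarith [hy.2.1, hy.2.2, Real.pi_gt_three]
  · rintro _ ⟨θ, hθ, rfl⟩
    exact ⟨by simp [ha], hθ.1⟩

/-- A local form of Poncelet closure: a real chord, distinct vertices and acuteness are open
conditions, so every unit `z` near `a` is a vertex of an acute triangle of the family. -/
theorem exists_isogonalFoci_norm_ne {f g a b c : ℂ} (hf : ‖f‖ ≠ 1) (hg : ‖g‖ ≠ 1)
    (ha : ‖a‖ = 1) (hb : ‖b‖ = 1) (hc : ‖c‖ = 1) (hab : a ≠ b) (hbc : b ≠ c) (hca : c ≠ a)
    (h : IsogonalFoci f g a b c) (hacute : ‖a + b + c‖ < 1)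
    (hf0 : f ≠ 0) (hg0 : g ≠ 0) (hfg : f + g ≠ 0) :
    ∃ a' b' c' : ℂ, ‖a'‖ = 1 ∧ ‖b'‖ = 1 ∧ ‖c'‖ = 1 ∧ a' ≠ b' ∧ b' ≠ c' ∧ c' ≠ a' ∧
      IsogonalFoci f g a' b' c' ∧ ‖a' + b' + c'‖ < 1 ∧ ‖a' + b' + c'‖ ≠ ‖a + b + c‖ := by
  by_contra! hcon
  have hs := h.add_eq_oppositeSum hf hg ha hb hc
  have hp := h.mul_eq_oppositeProd hf hg ha hb hc
  have hcs := continuousAt_oppositeSum hf hg ha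
  have hcp := continuousAt_oppositeProd hf hg ha
  have hlt : ‖oppositeSum f g a‖ < 2 := by
    rw [← hs]
    have h2 : ‖b + c‖ ^ 2 + ‖b - c‖ ^ 2 = 4 := by
      have := parallelogram_law_with_norm ℝ b c
      rw [hb, hc] at this
      linarith
    have h3 : 0 < ‖b - c‖ := norm_pos_iff.2 (sub_ne_zero.2 hbc)
    nlinarith [norm_nonneg (b + c)]
  have ev1 : ∀ᶠ z in nhds a, ‖oppositeSum f g z‖ < 2 :=
    hcs.norm.eventually_lt continuousAt_const hlt
  -- This expression is the product of the differences between `z` and the two other vertices.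
  have ev2 : ∀ᶠ z in nhds a, z ^ 2 - oppositeSum f g z * z + oppositeProd f g z ≠ 0 := by
    refine ContinuousAt.eventually_ne (by fun_prop) ?_
    rw [← hs, ← hp, show a ^ 2 - (b + c) * a + b * c = (a - b) * (a - c) by ring]
    exact mul_ne_zero (sub_ne_zero.2 hab) (sub_ne_zero.2 hca.symm)
  have ev3 : ∀ᶠ z in nhds a, ‖z + oppositeSum f g z‖ < 1 := by
    refine ContinuousAt.eventually_lt (by fun_prop) continuousAt_const ?_
    rwa [← hs, ← add_assoc]
  have hinf := infinite_unit_of_eventually ha (ev1.and (ev2.and ev3))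
  set k := ‖a + b + c‖ with hk
  let w := (conj f + conj g) * (conj f * conj g)
  let N : Polynomial ℂ := Polynomial.X * (Polynomial.X - Polynomial.C f) *
    (Polynomial.X - Polynomial.C g)
  let D : Polynomial ℂ := (1 - Polynomial.X * Polynomial.C (conj f)) *
    (1 - Polynomial.X * Polynomial.C (conj g))
  let q : Polynomial ℂ := Polynomial.C w * N ^ 2 + Polynomial.C ((f + g) * (conj f + conj g) +
    f * g * (conj f * conj g) - (k : ℂ) ^ 2) * (N * D) + Polynomial.C (conj w) * D ^ 2
  have hq : q = 0 := by
    refine Polynomial.eq_zero_of_infinite_isRoot q (hinf.mono ?_)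
    rintro z ⟨hz, hz1, hz2, hz3⟩
    obtain ⟨b', c', hb', hc', h1, h2, h3, h4, h5⟩ := exists_isogonalFoci_of_vertex hf hg hz hz1 hz2
    have h6 := hcon z b' c' hz hb' hc' h1 h2 h3 h4 (by rwa [h5])
    have h7 := add_oppositeSum_normSq_mul hf hg hz
    rw [← h5, h6] at h7
    simpa [q, N, D, w, mul_comm z] using h7
  -- At zero `N` vanishes and `D` is one, so only `conj w` remains.
  have h0 := congrArg (Polynomial.eval 0) hq
  have hw : conj w ≠ 0 := by
    simp only [w, map_add, map_mul, Complex.conj_conj]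
    exact mul_ne_zero hfg (mul_ne_zero hf0 hg0)
  simp [q, N, D] at h0
  exact hw (by rw [h0, map_zero])

/-! ### Tangency to an ellipse as a vanishing discriminant -/

theorem existsUnique_quadratic_root_iff {A B C : ℝ} (hA : A ≠ 0) :
    (∃! t : ℝ, A * (t * t) + B * t + C = 0) ↔ discrim A B C = 0 := by
  constructor
  · rintro ⟨t, ht, hu⟩
    -- By Vieta `-B / A - t` is also a root, so uniqueness makes `t` a double root.
    have h : -B / A - t = t := by
      apply hu
      change A * (t * t) + B * t + C = 0 at ht
      field_simp
      linear_combination A * ht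
    have h2 : 2 * A * t + B = 0 := by
      field_simp at h
      linear_combination -h
    rw [discrim_eq_sq_of_quadratic_eq_zero ht, h2]
    ring
  · intro h
    refine ⟨-B / (2 * A), ?_, fun t ht => ?_⟩
    · exact (quadratic_eq_zero_iff_of_discrim_eq_zero hA h _).2 rfl
    · exact (quadratic_eq_zero_iff_of_discrim_eq_zero hA h _).1 ht

/-- The polynomial is Heron's product for sides `2m`, `u`, `v`. Under the strict inequality, only
the factor `2m - u - v` can vanish. -/
theorem add_eq_two_mul_iff_of_abs_sub_lt {u v m : ℝ} (hv : 0 ≤ v)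
    (h : |u - v| < 2 * m) :
    u + v = 2 * m ↔ 4 * (2 * m) ^ 2 * u ^ 2 - ((2 * m) ^ 2 + u ^ 2 - v ^ 2) ^ 2 = 0 := by
  obtain ⟨h1, h2⟩ := abs_lt.1 h
  constructor
  · intro h
    have : v = 2 * m - u := by linarith
    subst this
    ring
  · intro h
    have h3 : (2 * m - u - v) * ((2 * m - u + v) * ((2 * m + u - v) * (2 * m + u + v))) = 0 := by
      linear_combination -h
    have h4 : (2 * m - u + v) * ((2 * m + u - v) * (2 * m + u + v)) ≠ 0 := by
      have : 0 < 2 * m - u + v := by linarith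
      have : 0 < 2 * m + u - v := by linarith
      have : 0 < 2 * m + u + v := by linarith
      positivity
    linarith [(mul_eq_zero.1 h3).resolve_right h4]

/-- Rationalizing the focal sum along the line gives a quadratic in `t`. Its discriminant vanishes
exactly when the product of the signed distances from the foci to the line is the squared semi-minor
axis. -/
theorem existsUnique_norm_add_norm_eq_iff {w₁ w₂ u : ℂ} {m : ℝ} (hu : u ≠ 0)
    (hm : ‖w₁ - w₂‖ < 2 * m) :
    (∃! t : ℝ, ‖w₁ + t * u‖ + ‖w₂ + t * u‖ = 2 * m) ↔
      4 * ((conj u * w₁).im * (conj u * w₂).im) =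
        Complex.normSq u * ((2 * m) ^ 2 - ‖w₁ - w₂‖ ^ 2) := by
  set k := (2 * m) ^ 2 with hk
  have hk0 : 0 < k := by
    have : 0 < 2 * m := (norm_nonneg _).trans_lt hm
    positivity
  have hmk : 0 < k - ‖w₁ - w₂‖ ^ 2 := by
    have := norm_nonneg (w₁ - w₂)
    nlinarith
  set W := Complex.normSq u with hW
  have hW0 : 0 < W := Complex.normSq_pos.2 hu
  set α := (conj u * w₁).re with hα
  set γ := (conj u * w₂).re with hγ
  set δ₁ := (conj u * w₁).im with hδ₁
  set δ₂ := (conj u * w₂).im with hδ₂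
  set x := Complex.normSq w₁ with hx
  set y := Complex.normSq w₂ with hy
  have hx' : α ^ 2 + δ₁ ^ 2 = W * x := by
    simp only [hα, hδ₁, hW, hx, Complex.normSq_apply, Complex.mul_re, Complex.mul_im,
      Complex.conj_re, Complex.conj_im]
    ring
  have hy' : γ ^ 2 + δ₂ ^ 2 = W * y := by
    simp only [hγ, hδ₂, hW, hy, Complex.normSq_apply, Complex.mul_re, Complex.mul_im,
      Complex.conj_re, Complex.conj_im]
    ring
  have hdist : W * ‖w₁ - w₂‖ ^ 2 = (α - γ) ^ 2 + (δ₁ - δ₂) ^ 2 := by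
    rw [← Complex.normSq_eq_norm_sq]
    simp only [hα, hδ₁, hγ, hδ₂, hW, Complex.normSq_apply, Complex.mul_re, Complex.mul_im,
      Complex.conj_re, Complex.conj_im, Complex.sub_re, Complex.sub_im]
    ring
  have hn₁ : ∀ t : ℝ, ‖w₁ + t * u‖ ^ 2 = x + 2 * α * t + W * t ^ 2 := by
    intro t
    rw [← Complex.normSq_eq_norm_sq]
    simp only [hα, hW, hx, Complex.normSq_apply, Complex.mul_re, Complex.mul_im, Complex.add_re,
      Complex.add_im, Complex.conj_re, Complex.conj_im, Complex.ofReal_re, Complex.ofReal_im]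
    ring
  have hn₂ : ∀ t : ℝ, ‖w₂ + t * u‖ ^ 2 = y + 2 * γ * t + W * t ^ 2 := by
    intro t
    rw [← Complex.normSq_eq_norm_sq]
    simp only [hγ, hW, hy, Complex.normSq_apply, Complex.mul_re, Complex.mul_im, Complex.add_re,
      Complex.add_im, Complex.conj_re, Complex.conj_im, Complex.ofReal_re, Complex.ofReal_im]
    ring
  have hiff : ∀ t : ℝ, ‖w₁ + t * u‖ + ‖w₂ + t * u‖ = 2 * m ↔
      (4 * (k * W - (α - γ) ^ 2)) * (t * t) + (8 * k * α - 4 * (k + x - y) * (α - γ)) * t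
        + (4 * k * x - (k + x - y) ^ 2) = 0 := by
    intro t
    rw [add_eq_two_mul_iff_of_abs_sub_lt (norm_nonneg _), hn₁, hn₂]
    · rw [← hk]
      refine Eq.congr_left ?_
      ring
    · refine (abs_norm_sub_norm_le _ _).trans_lt ?_
      rwa [add_sub_add_right_eq_sub]
  -- By `hdist` this quantity is `W * (k - ‖w₁ - w₂‖ ^ 2)`; it is the discriminant factor that never
  -- vanishes.
  have hsecond : 0 < k * W - (α - γ) ^ 2 - (δ₁ - δ₂) ^ 2 := by nlinarith
  have hA : 4 * (k * W - (α - γ) ^ 2) ≠ 0 := by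
    have : 0 < k * W - (α - γ) ^ 2 := by nlinarith [sq_nonneg (δ₁ - δ₂)]
    positivity
  simp only [hiff]
  rw [existsUnique_quadratic_root_iff hA]
  have hdisc : W * discrim (4 * (k * W - (α - γ) ^ 2)) (8 * k * α - 4 * (k + x - y) * (α - γ))
      (4 * k * x - (k + x - y) ^ 2) = 16 * k * (k * W - (α - γ) ^ 2 - (δ₁ - δ₂) ^ 2) *
        (k * W - (α - γ) ^ 2 - (δ₁ + δ₂) ^ 2) := by
    have e₁ : δ₁ ^ 2 = W * x - α ^ 2 := by linarith
    have e₂ : δ₂ ^ 2 = W * y - γ ^ 2 := by linarith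
    have : (k * W - (α - γ) ^ 2 - (δ₁ - δ₂) ^ 2) * (k * W - (α - γ) ^ 2 - (δ₁ + δ₂) ^ 2) =
        (k * W - (α - γ) ^ 2) ^ 2 - 2 * (k * W - (α - γ) ^ 2) * (δ₁ ^ 2 + δ₂ ^ 2)
          + (δ₁ ^ 2 - δ₂ ^ 2) ^ 2 := by ring
    rw [mul_assoc (16 * k), this, e₁, e₂]
    unfold discrim
    ring
  rw [← mul_eq_zero_iff_left hW0.ne', hdisc, mul_eq_zero_iff_left (by positivity)]
  constructor <;> intro h <;> linarith

theorem four_mul_im_mul_im_eq_iff_chordTangent {f g a b : ℂ} {κ : ℝ} (ha : ‖a‖ = 1) (hb : ‖b‖ = 1)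
    (hab : a ≠ b) :
    4 * ((conj (b - a) * (a - f)).im * (conj (b - a) * (a - g)).im) =
        Complex.normSq (b - a) * (4 * κ) ↔ ChordTangent f g κ a b := by
  have ha0 := ne_zero_of_norm_eq_one ha
  have hb0 := ne_zero_of_norm_eq_one hb
  have hu : b - a ≠ 0 := sub_ne_zero.2 hab.symm
  rw [← Complex.ofReal_inj]
  unfold ChordTangent
  simp only [Complex.ofReal_mul, Complex.ofReal_ofNat, Complex.im_eq_sub_conj,
    ← Complex.mul_conj, map_mul, map_sub, map_inv₀, inv_inv,
    conj_eq_inv_of_norm_eq_one ha, conj_eq_inv_of_norm_eq_one hb]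
  have e : ∀ w w' : ℂ, ((b⁻¹ - a⁻¹) * (a - w) - (b - a) * (a⁻¹ - w')) / (2 * Complex.I) =
      -((b - a) / (a * b)) * (a + b - w - a * b * w') / (2 * Complex.I) := by
    intro w w'
    field_simp
    ring
  rw [e, e]
  have e2 : 4 * (-((b - a) / (a * b)) * (a + b - f - a * b * conj f) / (2 * Complex.I) *
      (-((b - a) / (a * b)) * (a + b - g - a * b * conj g) / (2 * Complex.I))) =
      -((b - a) / (a * b)) ^ 2 * ((a + b - f - a * b * conj f) * (a + b - g - a * b * conj g)) := by
    field_simp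
    rw [Complex.I_sq]
    ring
  have e3 : (b - a) * (b⁻¹ - a⁻¹) * (4 * (κ : ℂ)) =
      -((b - a) / (a * b)) ^ 2 * (4 * (a * b) * κ) := by
    field_simp
    ring
  rw [e2, e3]
  refine mul_right_inj' ?_
  exact neg_ne_zero.2 (pow_ne_zero _ (div_ne_zero hu (mul_ne_zero ha0 hb0)))

/-! ### Complex coordinates on the plane, and tangency expressed in them -/

/-- The complex coordinate on the plane with origin `O` and unit length `R`. -/
noncomputable def chart (O : Plane) (R : ℝ) (z : ℂ) : Plane :=
  O + R • Complex.orthonormalBasisOneI.repr z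

section chart

variable {O : Plane} {R : ℝ}

theorem chart_sub_chart (z w : ℂ) :
    chart O R z - chart O R w = R • Complex.orthonormalBasisOneI.repr (z - w) := by
  simp only [chart, map_sub, smul_sub]
  abel

@[simp] theorem chart_zero : chart O R 0 = O := by simp [chart]

theorem dist_chart (hR : 0 < R) (z w : ℂ) : dist (chart O R z) (chart O R w) = R * ‖z - w‖ := by
  rw [dist_eq_norm, chart_sub_chart, norm_smul, LinearIsometryEquiv.norm_map, Real.norm_eq_abs,
    abs_of_pos hR]

theorem dist_chart_origin (hR : 0 < R) (z : ℂ) : dist (chart O R z) O = R * ‖z‖ := by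
  have h := dist_chart (O := O) hR z 0
  rwa [chart_zero, sub_zero] at h

theorem inner_chart_sub_chart (z w u v : ℂ) :
    inner ℝ (chart O R z - chart O R w) (chart O R u - chart O R v) =
      R ^ 2 * ((u - v) * conj (z - w)).re := by
  rw [chart_sub_chart, chart_sub_chart, real_inner_smul_left, real_inner_smul_right,
    LinearIsometryEquiv.inner_map_map, Complex.inner]
  ring

theorem chart_injective (hR : 0 < R) : Function.Injective (chart O R) := by
  intro z w h
  have := dist_chart (O := O) hR z w
  rw [h, dist_self, eq_comm, mul_eq_zero, norm_eq_zero, sub_eq_zero] at this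
  exact this.resolve_left hR.ne'

theorem chart_surjective (hR : 0 < R) : Function.Surjective (chart O R) := by
  intro X
  refine ⟨Complex.orthonormalBasisOneI.repr.symm (R⁻¹ • (X - O)), ?_⟩
  rw [chart, LinearIsometryEquiv.apply_symm_apply, smul_inv_smul₀ hR.ne', add_sub_cancel]

theorem chart_add_smul_sub (a b : ℂ) (t : ℝ) :
    chart O R (a + t * (b - a)) = AffineMap.lineMap (chart O R a) (chart O R b) t := by
  rw [AffineMap.lineMap_apply, vsub_eq_sub, vadd_eq_add, chart_sub_chart, chart, chart,
    ← Complex.real_smul, map_add, map_smul, smul_add, smul_comm t R]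
  abel

theorem chart_mem_line_iff (hR : 0 < R) {z a b : ℂ} :
    chart O R z ∈ affineSpan ℝ {chart O R a, chart O R b} ↔ ∃ t : ℝ, a + t * (b - a) = z := by
  rw [mem_affineSpan_pair_iff_exists_lineMap_eq]
  simp only [← chart_add_smul_sub, (chart_injective hR).eq_iff]

theorem chart_midpoint (a b : ℂ) :
    chart O R ((a + b) / 2) = midpoint ℝ (chart O R a) (chart O R b) := by
  rw [midpoint, ← chart_add_smul_sub]
  congr 1
  rw [show ((⅟2 : ℝ) : ℂ) = 1 / 2 by norm_num]
  ring

end chart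

/-- The squared semi-minor axis of an ellipse, in the unit of length `R`. -/
noncomputable def Ellipse.semiMinorSq (E : Ellipse) (R : ℝ) : ℝ :=
  ((2 * E.semiMajor) ^ 2 - dist E.focus₁ E.focus₂ ^ 2) / (4 * R ^ 2)

theorem Ellipse.semiMinorSq_pos (E : Ellipse) {R : ℝ} (hR : 0 < R) : 0 < E.semiMinorSq R := by
  have h := E.dist_lt
  have h0 := dist_nonneg (x := E.focus₁) (y := E.focus₂)
  refine div_pos ?_ (by positivity)
  nlinarith

theorem Ellipse.isTangentLine_chart_iff {E : Ellipse} {O : Plane} {R : ℝ} (hR : 0 < R)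
    {f g a b : ℂ} (hf : E.focus₁ = chart O R f) (hg : E.focus₂ = chart O R g)
    (ha : ‖a‖ = 1) (hb : ‖b‖ = 1) (hab : a ≠ b) :
    E.IsTangentLine (affineSpan ℝ {chart O R a, chart O R b}) ↔
      ChordTangent f g (E.semiMinorSq R) a b := by
  have hu : b - a ≠ 0 := sub_ne_zero.2 hab.symm
  have hdist : dist E.focus₁ E.focus₂ = R * ‖f - g‖ := by rw [hf, hg, dist_chart hR]
  have hm : ‖(a - f) - (a - g)‖ < 2 * (E.semiMajor / R) := by
    have := E.dist_lt
    rw [hdist] at this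
    rw [sub_sub_sub_cancel_left, norm_sub_rev, ← mul_div_assoc, lt_div_iff₀ hR]
    linarith
  have hcurve : ∀ t : ℝ, chart O R (a + t * (b - a)) ∈ E.curve ↔
      ‖(a - f) + t * (b - a)‖ + ‖(a - g) + t * (b - a)‖ = 2 * (E.semiMajor / R) := by
    intro t
    rw [Ellipse.curve, Set.mem_ofPred_eq, hf, hg, dist_chart hR, dist_chart hR, ← mul_div_assoc,
      eq_div_iff hR.ne', show a + t * (b - a) - f = a - f + t * (b - a) by ring,
      show a + t * (b - a) - g = a - g + t * (b - a) by ring]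
    constructor <;> intro h <;> linarith
  have hline : E.IsTangentLine (affineSpan ℝ {chart O R a, chart O R b}) ↔
      ∃! t : ℝ, chart O R (a + t * (b - a)) ∈ E.curve := by
    constructor
    · rintro ⟨X, ⟨hX, hXE⟩, hun⟩
      obtain ⟨z, rfl⟩ := chart_surjective (O := O) hR X
      obtain ⟨t, rfl⟩ := (chart_mem_line_iff hR).1 hX
      refine ⟨t, hXE, fun s hs => ?_⟩
      have h := chart_injective hR (hun _ ⟨(chart_mem_line_iff hR).2 ⟨s, rfl⟩, hs⟩)
      exact_mod_cast mul_right_cancel₀ hu (add_left_cancel h)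
    · rintro ⟨t, ht, hun⟩
      refine ⟨_, ⟨(chart_mem_line_iff hR).2 ⟨t, rfl⟩, ht⟩, ?_⟩
      rintro X ⟨hX, hXE⟩
      obtain ⟨z, rfl⟩ := chart_surjective (O := O) hR X
      obtain ⟨s, rfl⟩ := (chart_mem_line_iff hR).1 hX
      rw [hun s hXE]
  rw [hline]
  simp only [hcurve]
  rw [existsUnique_norm_add_norm_eq_iff hu hm, ← four_mul_im_mul_im_eq_iff_chordTangent ha hb hab]
  refine Eq.congr_right (congrArg _ ?_)
  rw [sub_sub_sub_cancel_left, norm_sub_rev, Ellipse.semiMinorSq, hdist]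
  field_simp

/-! ### Acuteness, altitude feet and the orthic incircle on the unit circle -/

/-- The cosine-like quantity at the vertex `a` of the triangle `a b c`. -/
def vertexInner (a b c : ℂ) : ℝ := ((b - a) * conj (c - a)).re

theorem vertexInner_comm (a b c : ℂ) : vertexInner a c b = vertexInner a b c := by
  simp only [vertexInner, map_sub, Complex.mul_re, Complex.sub_re, Complex.sub_im, Complex.conj_re,
    Complex.conj_im]
  ring

theorem vertexInner_add_vertexInner (a b c : ℂ) :
    vertexInner a b c + vertexInner b c a = ‖a - b‖ ^ 2 := by
  rw [← Complex.normSq_eq_norm_sq]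
  simp only [vertexInner, Complex.normSq_apply, map_sub, Complex.mul_re, Complex.sub_re,
    Complex.sub_im, Complex.conj_re, Complex.conj_im]
  ring

/-- The foot of the altitude from `a` in the triangle `a b c` inscribed in the unit circle. -/
noncomputable def unitFoot (a b c : ℂ) : ℂ := (a + b + c - b * c / a) / 2

/-- The inradius of the orthic triangle of the acute triangle `a b c` inscribed in the unit
circle. -/
noncomputable def unitOrthicInradius (a b c : ℂ) : ℝ := (1 - ‖a + b + c‖ ^ 2) / 4

theorem exists_ofReal_of_conj_div_eq {x y : ℂ} (hy : y ≠ 0) (h : conj (x / y) = x / y) :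
    ∃ t : ℝ, t * y = x := by
  obtain ⟨t, ht⟩ := Complex.conj_eq_iff_real.1 h
  exact ⟨t, by rw [← ht, div_mul_cancel₀ _ hy]⟩

theorem re_eq_zero_of_conj_eq_neg {z : ℂ} (h : conj z = -z) : z.re = 0 := by
  have := congrArg Complex.re h
  rw [Complex.conj_re, Complex.neg_re] at this
  linarith

section

variable {a b c : ℂ} (ha : ‖a‖ = 1) (hb : ‖b‖ = 1) (hc : ‖c‖ = 1)

include ha hb hc

theorem two_mul_vertexInner :
    2 * (vertexInner a b c : ℂ) = (b - a) * (a - c) * (b + c) / (a * b * c) := by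
  have ha0 := ne_zero_of_norm_eq_one ha
  have hb0 := ne_zero_of_norm_eq_one hb
  have hc0 := ne_zero_of_norm_eq_one hc
  rw [vertexInner, Complex.re_eq_add_conj]
  simp only [map_mul, map_sub, map_inv₀, inv_inv,
    conj_eq_inv_of_norm_eq_one ha, conj_eq_inv_of_norm_eq_one hb, conj_eq_inv_of_norm_eq_one hc]
  field_simp
  ring

theorem norm_add_add_sq :
    (‖a + b + c‖ : ℂ) ^ 2 = (a + b + c) * (a⁻¹ + b⁻¹ + c⁻¹) := by
  rw [← Complex.mul_conj']
  simp only [map_add, conj_eq_inv_of_norm_eq_one ha, conj_eq_inv_of_norm_eq_one hb,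
    conj_eq_inv_of_norm_eq_one hc]

omit hc in
theorem norm_sub_sq_of_norm_eq_one : (‖a - b‖ : ℂ) ^ 2 = (a - b) * (a⁻¹ - b⁻¹) := by
  rw [← Complex.mul_conj']
  simp only [map_sub, conj_eq_inv_of_norm_eq_one ha, conj_eq_inv_of_norm_eq_one hb]

theorem ofReal_unitOrthicInradius :
    (unitOrthicInradius a b c : ℂ) = (1 - (a + b + c) * (a⁻¹ + b⁻¹ + c⁻¹)) / 4 := by
  rw [← norm_add_add_sq ha hb hc]
  simp [unitOrthicInradius]

/-- This is `1 - |OH|² = 8 cos A cos B cos C` for circumradius one, multiplied by the squared sides.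
-/
theorem vertexInner_mul_mul :
    8 * (vertexInner a b c * vertexInner b c a * vertexInner c a b) =
      ‖a - b‖ ^ 2 * ‖b - c‖ ^ 2 * ‖c - a‖ ^ 2 * (1 - ‖a + b + c‖ ^ 2) := by
  have ha0 := ne_zero_of_norm_eq_one ha
  have hb0 := ne_zero_of_norm_eq_one hb
  have hc0 := ne_zero_of_norm_eq_one hc
  rw [← Complex.ofReal_inj]
  push_cast
  rw [norm_add_add_sq ha hb hc, norm_sub_sq_of_norm_eq_one ha hb, norm_sub_sq_of_norm_eq_one hb hc,
    norm_sub_sq_of_norm_eq_one hc ha]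
  have e : (8 : ℂ) * (vertexInner a b c * vertexInner b c a * vertexInner c a b) =
    (2 * vertexInner a b c) * (2 * vertexInner b c a) * (2 * vertexInner c a b) := by ring
  rw [e, two_mul_vertexInner ha hb hc, two_mul_vertexInner hb hc ha, two_mul_vertexInner hc ha hb]
  field_simp
  ring

theorem vertexInner_pos_iff (hab : a ≠ b) (hbc : b ≠ c) (hca : c ≠ a) :
    (0 < vertexInner a b c ∧ 0 < vertexInner b c a ∧ 0 < vertexInner c a b) ↔
      ‖a + b + c‖ < 1 := by
  have h := vertexInner_mul_mul ha hb hc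
  have h₁ := vertexInner_add_vertexInner a b c
  have h₂ := vertexInner_add_vertexInner b c a
  have h₃ := vertexInner_add_vertexInner c a b
  have p₁ : 0 < ‖a - b‖ ^ 2 := pow_pos (norm_pos_iff.2 (sub_ne_zero.2 hab)) 2
  have p₂ : 0 < ‖b - c‖ ^ 2 := pow_pos (norm_pos_iff.2 (sub_ne_zero.2 hbc)) 2
  have p₃ : 0 < ‖c - a‖ ^ 2 := pow_pos (norm_pos_iff.2 (sub_ne_zero.2 hca)) 2
  have hn : ‖a + b + c‖ < 1 ↔ 0 < 1 - ‖a + b + c‖ ^ 2 := by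
    rw [sub_pos, sq_lt_one_iff₀ (norm_nonneg _)]
  rw [hn, ← mul_pos_iff_of_pos_left (b := 1 - _) (mul_pos (mul_pos p₁ p₂) p₃), ← h]
  set x := vertexInner a b c
  set y := vertexInner b c a
  set z := vertexInner c a b
  constructor
  · rintro ⟨hx, hy, hz⟩
    positivity
  · intro hpos
    have hxyz : 0 < x * y * z := by linarith
    -- Pairwise sums are squared sides, hence positive, so at most one factor can be nonpositive; a
    -- positive product excludes even that one.
    have aux : ∀ x y z : ℝ, 0 < x + y → 0 < z + x → 0 < x * y * z → 0 < x := by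
      intro x y z hxy hzx hxyz
      by_contra! hx
      have : 0 < y * z := mul_pos (by linarith) (by linarith)
      nlinarith
    refine ⟨aux x y z (by linarith) (by linarith) hxyz, aux y z x (by linarith) (by linarith) ?_,
      aux z x y (by linarith) (by linarith) ?_⟩ <;> linarith

theorem exists_unitFoot_eq (hbc : b ≠ c) : ∃ t : ℝ, b + t * (c - b) = unitFoot a b c := by
  have ha0 := ne_zero_of_norm_eq_one ha
  have hb0 := ne_zero_of_norm_eq_one hb
  have hc0 := ne_zero_of_norm_eq_one hc
  have hcb : c - b ≠ 0 := sub_ne_zero.2 hbc.symm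
  have hbc' : b - c ≠ 0 := sub_ne_zero.2 hbc
  obtain ⟨t, ht⟩ := exists_ofReal_of_conj_div_eq (x := (a - b) * (a + c) / (2 * a)) hcb (by
    simp only [map_mul, map_sub, map_add, map_div₀, Complex.conj_ofNat,
      conj_eq_inv_of_norm_eq_one ha, conj_eq_inv_of_norm_eq_one hb, conj_eq_inv_of_norm_eq_one hc]
    have : c⁻¹ - b⁻¹ = (b - c) / (b * c) := by field_simp
    rw [this]
    field_simp
    ring)
  refine ⟨t, ?_⟩
  rw [ht, unitFoot]
  field_simp
  ring

theorem re_sub_unitFoot_mul_conj : ((a - unitFoot a b c) * conj (b - c)).re = 0 := by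
  have ha0 := ne_zero_of_norm_eq_one ha
  have hb0 := ne_zero_of_norm_eq_one hb
  have hc0 := ne_zero_of_norm_eq_one hc
  apply re_eq_zero_of_conj_eq_neg
  simp only [unitFoot, map_mul, map_sub, map_add, map_div₀, Complex.conj_ofNat, map_inv₀, inv_inv,
      conj_eq_inv_of_norm_eq_one ha, conj_eq_inv_of_norm_eq_one hb, conj_eq_inv_of_norm_eq_one hc]
  field_simp
  ring

omit ha in
theorem unitFoot_sub_unitFoot :
    unitFoot b c a - unitFoot c a b = a * (b - c) * (b + c) / (2 * (b * c)) := by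
  have hb0 := ne_zero_of_norm_eq_one hb
  have hc0 := ne_zero_of_norm_eq_one hc
  rw [unitFoot, unitFoot]
  field_simp
  ring

/-- The orthic side joining the feet from `b` and `c` is perpendicular to the radius to `a`, so the
point where the incircle centered at `H` touches it lies in direction `a` from `H`. The parameter is
real because the relevant quotient is its own conjugate. -/
theorem exists_orthic_touchpoint_eq (hbc : b ≠ c) (hbc' : b + c ≠ 0) :
    ∃ t : ℝ, unitFoot b c a + t * (unitFoot c a b - unitFoot b c a) =
      a + b + c + unitOrthicInradius a b c * a := by
  have ha0 := ne_zero_of_norm_eq_one ha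
  have hb0 := ne_zero_of_norm_eq_one hb
  have hc0 := ne_zero_of_norm_eq_one hc
  have hs : b - c ≠ 0 := sub_ne_zero.2 hbc
  have hs' : c - b ≠ 0 := sub_ne_zero.2 hbc.symm
  have hcb' : c + b ≠ 0 := by rwa [add_comm]
  have hr := ofReal_unitOrthicInradius ha hb hc
  set r : ℂ := (unitOrthicInradius a b c : ℂ) with hr_def
  obtain ⟨t, ht⟩ := exists_ofReal_of_conj_div_eq (y := a * (b - c) * (b + c) / (2 * (b * c)))
      (x := -(a + b + c + r * a - unitFoot b c a)) (by
    apply div_ne_zero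
    · exact mul_ne_zero (mul_ne_zero ha0 hs) hbc'
    · exact mul_ne_zero two_ne_zero (mul_ne_zero hb0 hc0)) (by
    have e : (b⁻¹ - c⁻¹) = -((b - c) / (b * c)) := by field_simp; ring
    have e' : (b⁻¹ + c⁻¹) = (b + c) / (b * c) := by field_simp; ring
    have hrc : conj r = r := by rw [hr_def, Complex.conj_ofReal]
    simp only [unitFoot, map_mul, map_sub, map_neg, map_add, map_div₀, Complex.conj_ofNat, hrc,
      conj_eq_inv_of_norm_eq_one ha, conj_eq_inv_of_norm_eq_one hb, conj_eq_inv_of_norm_eq_one hc]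
    rw [e, e', hr]
    field_simp
    ring)
  refine ⟨t, ?_⟩
  rw [← neg_sub (unitFoot b c a), unitFoot_sub_unitFoot hb hc, mul_neg, ht]
  ring

theorem re_mul_conj_unitFoot_sub (r : ℝ) :
    ((a + b + c - (a + b + c + r * a)) * conj (unitFoot b c a - unitFoot c a b)).re = 0 := by
  have ha0 := ne_zero_of_norm_eq_one ha
  have hb0 := ne_zero_of_norm_eq_one hb
  have hc0 := ne_zero_of_norm_eq_one hc
  apply re_eq_zero_of_conj_eq_neg
  rw [unitFoot_sub_unitFoot hb hc]
  simp only [map_mul, map_sub, map_add, map_div₀, Complex.conj_ofNat, map_inv₀, inv_inv,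
    Complex.conj_ofReal,
      conj_eq_inv_of_norm_eq_one ha, conj_eq_inv_of_norm_eq_one hb, conj_eq_inv_of_norm_eq_one hc]
  field_simp
  ring

end

/-- The barycentric coordinate of the incenter of the orthic triangle. -/
noncomputable def orthicWeight (a b c : ℂ) : ℝ :=
  2 * vertexInner a b c / (‖c - a‖ ^ 2 * ‖a - b‖ ^ 2)

section

variable {a b c : ℂ} (ha : ‖a‖ = 1) (hb : ‖b‖ = 1) (hc : ‖c‖ = 1)
  (hab : a ≠ b) (hbc : b ≠ c) (hca : c ≠ a)

include ha hb hc hab hca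

theorem ofReal_orthicWeight :
    (orthicWeight a b c : ℂ) = -(a * (b + c)) / ((a - b) * (a - c)) := by
  have ha0 := ne_zero_of_norm_eq_one ha
  have hb0 := ne_zero_of_norm_eq_one hb
  have hc0 := ne_zero_of_norm_eq_one hc
  have h1 : a - b ≠ 0 := sub_ne_zero.2 hab
  have h2 : b - a ≠ 0 := sub_ne_zero.2 hab.symm
  have h3 : c - a ≠ 0 := sub_ne_zero.2 hca
  have h4 : a - c ≠ 0 := sub_ne_zero.2 hca.symm
  rw [orthicWeight]
  push_cast
  rw [two_mul_vertexInner ha hb hc, norm_sub_sq_of_norm_eq_one hc ha,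
    norm_sub_sq_of_norm_eq_one ha hb]
  have e : a⁻¹ - b⁻¹ = (b - a) / (a * b) := by field_simp
  have e' : c⁻¹ - a⁻¹ = (a - c) / (a * c) := by field_simp
  rw [e, e']
  field_simp
  ring

omit ha hb hc in
theorem orthicWeight_pos (h : 0 < vertexInner a b c) : 0 < orthicWeight a b c := by
  have h1 : 0 < ‖a - b‖ := norm_pos_iff.2 (sub_ne_zero.2 hab)
  have h2 : 0 < ‖c - a‖ := norm_pos_iff.2 (sub_ne_zero.2 hca)
  unfold orthicWeight
  positivity

include hbc

theorem orthicWeight_add : orthicWeight a b c + orthicWeight b c a + orthicWeight c a b = 1 := by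
  rw [← Complex.ofReal_inj]
  push_cast
  rw [ofReal_orthicWeight ha hb hc hab hca, ofReal_orthicWeight hb hc ha hbc hab,
    ofReal_orthicWeight hc ha hb hca hbc, ← neg_sub b a, ← neg_sub c b, ← neg_sub a c]
  have h1 : b - a ≠ 0 := sub_ne_zero.2 hab.symm
  have h2 : c - b ≠ 0 := sub_ne_zero.2 hbc.symm
  have h3 : a - c ≠ 0 := sub_ne_zero.2 hca.symm
  field_simp
  ring

/-- The weights are proportional to `sin 2A`, `sin 2B`, `sin 2C`, which for an acute triangle are
proportional to the orthic sides. Their positivity later places `H` inside the orthic triangle. -/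
theorem orthicWeight_mul_unitFoot_add :
    orthicWeight a b c * unitFoot a b c + orthicWeight b c a * unitFoot b c a
      + orthicWeight c a b * unitFoot c a b = a + b + c := by
  have ha0 := ne_zero_of_norm_eq_one ha
  have hb0 := ne_zero_of_norm_eq_one hb
  have hc0 := ne_zero_of_norm_eq_one hc
  rw [ofReal_orthicWeight ha hb hc hab hca, ofReal_orthicWeight hb hc ha hbc hab,
    ofReal_orthicWeight hc ha hb hca hbc, ← neg_sub b a, ← neg_sub c b, ← neg_sub a c]
  have h1 : b - a ≠ 0 := sub_ne_zero.2 hab.symm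
  have h2 : c - b ≠ 0 := sub_ne_zero.2 hbc.symm
  have h3 : a - c ≠ 0 := sub_ne_zero.2 hca.symm
  simp only [unitFoot]
  field_simp
  ring

end

/-! ### Transfer to triangles in the plane -/

/-- The vertices of a triangle have the coordinates `z`, all on the unit circle, in the chart with
origin `O` and unit length `R`. -/
structure HasUnitCoords (T : Affine.Triangle ℝ Plane) (O : Plane) (R : ℝ) (z : Fin 3 → ℂ) :
    Prop where
  pos : 0 < R
  points_eq : ∀ i, T.points i = chart O R (z i)
  norm_eq : ∀ i, ‖z i‖ = 1

theorem exists_hasUnitCoords (T : Affine.Triangle ℝ Plane) :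
    ∃ z, HasUnitCoords T T.circumcenter T.circumradius z := by
  have hR : 0 < T.circumradius := T.circumradius_pos
  choose z hz using fun i => chart_surjective (O := T.circumcenter) hR (T.points i)
  refine ⟨z, hR, fun i => (hz i).symm, fun i => ?_⟩
  have h := T.dist_circumcenter_eq_circumradius i
  rw [← hz i, dist_chart_origin hR] at h
  exact (mul_eq_left₀ hR.ne').1 h

theorem affineSpan_range_points_eq_top (T : Affine.Triangle ℝ Plane) :
    affineSpan ℝ (Set.range T.points) = ⊤ := by
  refine T.independent.affineSpan_eq_top_iff_card_eq_finrank_add_one.2 ?_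
  simp [finrank_euclideanSpace]

theorem exists_triangle_hasUnitCoords {O : Plane} {R : ℝ} (hR : 0 < R) {z : Fin 3 → ℂ}
    (hz : ∀ i, ‖z i‖ = 1) (hinj : Function.Injective z) :
    ∃ T, HasUnitCoords T O R z := by
  refine ⟨⟨fun i => chart O R (z i), ?_⟩, hR, fun i => rfl, hz⟩
  have hs : EuclideanGeometry.Cospherical (Set.range fun i => chart O R (z i)) := by
    refine ⟨O, R, ?_⟩
    rintro _ ⟨i, rfl⟩
    rw [dist_chart_origin hR, hz, mul_one]
  exact hs.affineIndependent subset_rfl ((chart_injective hR).comp hinj)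

theorem image_compl_singleton {α : Type*} (p : Fin 3 → α) (i : Fin 3) :
    p '' {i}ᶜ = {p (i + 1), p (i + 2)} := by
  have : ({i}ᶜ : Set (Fin 3)) = {i + 1, i + 2} := by
    ext j
    simp only [Set.mem_compl_iff, Set.mem_singleton_iff, Set.mem_insert_iff]
    decide +revert
  rw [this, Set.image_pair]

theorem sum_fin_three_cyclic {M : Type*} [AddCommMonoid M] (x : Fin 3 → M) (i : Fin 3) :
    ∑ j, x j = x i + x (i + 1) + x (i + 2) := by
  rw [Fin.sum_univ_three]
  fin_cases i
  · rfl
  · change x 0 + x 1 + x 2 = x 1 + x 2 + x 0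
    abel
  · change x 0 + x 1 + x 2 = x 2 + x 0 + x 1
    abel

/-- Used twice: for the altitude feet of a triangle, and for the touchpoints on the sides of its
orthic triangle. -/
theorem orthogonalProjectionSpan_chart {T : Affine.Triangle ℝ Plane} {O : Plane} {R : ℝ}
    (hR : 0 < R) {z : Fin 3 → ℂ} (hz : ∀ i, T.points i = chart O R (z i)) (i : Fin 3) {x y : ℂ}
    (hy : ∃ t : ℝ, z (i + 1) + t * (z (i + 2) - z (i + 1)) = y)
    (hxy : ((x - y) * conj (z (i + 1) - z (i + 2))).re = 0) :
    ((T.faceOpposite i).orthogonalProjectionSpan (chart O R x) : Plane) = chart O R y := by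
  rw [Affine.Simplex.orthogonalProjectionSpan,
    EuclideanGeometry.coe_orthogonalProjection_eq_iff_mem, Affine.Simplex.range_faceOpposite_points,
    image_compl_singleton, hz, hz]
  refine ⟨(chart_mem_line_iff hR).2 hy, ?_⟩
  rw [direction_affineSpan, Submodule.mem_orthogonal]
  intro u hu
  rw [mem_vectorSpan_pair] at hu
  obtain ⟨r, rfl⟩ := hu
  rw [vsub_eq_sub, vsub_eq_sub, real_inner_smul_left, inner_chart_sub_chart, hxy]
  simp

theorem affineCombination_chart {O : Plane} {R : ℝ} (z : Fin 3 → ℂ) (w : Fin 3 → ℝ)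
    (hw : ∑ i, w i = 1) :
    Finset.univ.affineCombination ℝ (fun i => chart O R (z i)) w =
      chart O R (∑ i, w i * z i) := by
  rw [Finset.affineCombination_eq_linear_combination _ _ _ hw]
  simp only [chart, smul_add, Finset.sum_add_distrib, ← Finset.sum_smul, hw, one_smul, map_sum,
    Finset.smul_sum]
  congr 1
  refine Finset.sum_congr rfl fun i _ => ?_
  rw [← Complex.real_smul, map_smul, smul_comm]

theorem affineIndependent_chart {O : Plane} {R : ℝ} (hR : 0 < R) {z : Fin 3 → ℂ}
    (h : ((z 1 - z 0) * conj (z 2 - z 0)).im ≠ 0) :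
    AffineIndependent ℝ fun i => chart O R (z i) := by
  rw [affineIndependent_iff_not_collinear, collinear_iff_of_mem (Set.mem_range_self (0 : Fin 3))]
  rintro ⟨v, hv⟩
  have key : ∀ i, ∃ r : ℝ, z i - z 0 = r * Complex.orthonormalBasisOneI.repr.symm (R⁻¹ • v) := by
    intro i
    obtain ⟨r, hr⟩ := hv _ ⟨i, rfl⟩
    refine ⟨r, ?_⟩
    rw [vadd_eq_add, ← sub_eq_iff_eq_add, chart_sub_chart] at hr
    rw [← Complex.real_smul, ← map_smul, smul_comm, ← hr, inv_smul_smul₀ hR.ne',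
      LinearIsometryEquiv.symm_apply_apply]
  obtain ⟨r₁, h₁⟩ := key 1
  obtain ⟨r₂, h₂⟩ := key 2
  apply h
  rw [h₁, h₂, map_mul, Complex.conj_ofReal]
  simp only [Complex.mul_im, Complex.mul_re, Complex.ofReal_re, Complex.ofReal_im, Complex.conj_re,
    Complex.conj_im]
  ring

theorem angle_lt_pi_div_two_iff_inner_pos {p₁ p₂ p₃ : Plane} (h₁ : p₁ ≠ p₂) (h₃ : p₃ ≠ p₂) :
    EuclideanGeometry.angle p₁ p₂ p₃ < Real.pi / 2 ↔ 0 < inner ℝ (p₁ - p₂) (p₃ - p₂) := by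
  rw [EuclideanGeometry.angle, InnerProductGeometry.angle, Real.arccos_lt_pi_div_two, vsub_eq_sub,
    vsub_eq_sub, div_pos_iff_of_pos_right]
  exact mul_pos (norm_pos_iff.2 (sub_ne_zero.2 h₁)) (norm_pos_iff.2 (sub_ne_zero.2 h₃))

namespace HasUnitCoords

variable {T : Affine.Triangle ℝ Plane} {O : Plane} {R : ℝ} {z : Fin 3 → ℂ}
  (h : HasUnitCoords T O R z)

include h

theorem injective : Function.Injective z := by
  intro i j hij
  apply T.independent.injective
  rw [h.points_eq, h.points_eq, hij]

theorem circumsphere_eq : T.circumsphere = ⟨O, R⟩ := by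
  have hd : ∀ i, dist (T.points i) O = R := by
    intro i
    rw [h.points_eq, dist_chart_origin h.pos, h.norm_eq, mul_one]
  have hO : O ∈ affineSpan ℝ (Set.range T.points) := by
    rw [affineSpan_range_points_eq_top]
    trivial
  ext1
  · exact (T.eq_circumcenter_of_dist_eq hO hd).symm
  · exact (T.eq_circumradius_of_dist_eq hO hd).symm

theorem circumcenter_eq : T.circumcenter = O :=
  congrArg EuclideanGeometry.Sphere.center h.circumsphere_eq

theorem orthocenter_eq : T.orthocenter = chart O R (z 0 + z 1 + z 2) := by
  have h1 := T.orthocenter_vsub_circumcenter_eq_sum_vsub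
  rw [h.circumcenter_eq, vsub_eq_sub, sub_eq_iff_eq_add] at h1
  rw [h1, Fin.sum_univ_three, h.points_eq, h.points_eq, h.points_eq]
  simp only [chart, vsub_eq_sub, add_sub_cancel_left, map_add, smul_add]
  abel

theorem ne (i : Fin 3) : z i ≠ z (i + 1) ∧ z (i + 1) ≠ z (i + 2) ∧ z (i + 2) ≠ z i := by
  refine ⟨h.injective.ne ?_, h.injective.ne ?_, h.injective.ne ?_⟩ <;> decide +revert

theorem angle_lt_pi_div_two_iff {i j k : Fin 3} (hji : j ≠ i) (hki : k ≠ i) :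
    EuclideanGeometry.angle (T.points j) (T.points i) (T.points k) < Real.pi / 2 ↔
      0 < vertexInner (z i) (z j) (z k) := by
  rw [angle_lt_pi_div_two_iff_inner_pos (T.independent.injective.ne hji)
    (T.independent.injective.ne hki), h.points_eq, h.points_eq, h.points_eq, inner_chart_sub_chart,
    mul_pos_iff_of_pos_left (pow_pos h.pos 2)]
  exact Iff.of_eq (congrArg _ (vertexInner_comm _ _ _))

theorem acuteAngled_iff_vertexInner : T.AcuteAngled ↔
    0 < vertexInner (z 0) (z 1) (z 2) ∧ 0 < vertexInner (z 1) (z 2) (z 0) ∧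
      0 < vertexInner (z 2) (z 0) (z 1) := by
  rw [Affine.Triangle.acuteAngled_iff_angle_lt,
    h.angle_lt_pi_div_two_iff (by decide) (by decide),
    h.angle_lt_pi_div_two_iff (by decide) (by decide),
    h.angle_lt_pi_div_two_iff (by decide) (by decide), vertexInner_comm (z 1), vertexInner_comm (z 2),
    vertexInner_comm (z 0)]
  tauto

theorem acuteAngled_iff : T.AcuteAngled ↔ ‖z 0 + z 1 + z 2‖ < 1 := by
  rw [h.acuteAngled_iff_vertexInner]
  exact vertexInner_pos_iff (h.norm_eq 0) (h.norm_eq 1) (h.norm_eq 2) (h.ne 0).1 (h.ne 0).2.1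
    (h.ne 0).2.2

theorem vertexInner_pos (hT : T.AcuteAngled) (i : Fin 3) :
    0 < vertexInner (z i) (z (i + 1)) (z (i + 2)) := by
  obtain ⟨h0, h1, h2⟩ := h.acuteAngled_iff_vertexInner.1 hT
  fin_cases i
  · exact h0
  · exact h1
  · exact h2

theorem altitudeFoot_eq (i : Fin 3) :
    T.altitudeFoot i = chart O R (unitFoot (z i) (z (i + 1)) (z (i + 2))) := by
  rw [Affine.Simplex.altitudeFoot, h.points_eq]
  exact orthogonalProjectionSpan_chart h.pos h.points_eq i
    (exists_unitFoot_eq (h.norm_eq _) (h.norm_eq _) (h.norm_eq _) (h.ne i).2.1)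
    (re_sub_unitFoot_mul_conj (h.norm_eq _) (h.norm_eq _) (h.norm_eq _))

end HasUnitCoords

/-- Degeneracy of the triangle of feet reduces to the vanishing of a product of differences and sums
of vertices. A zero sum means that two vertices are antipodal, that is, a right angle at the third.
-/
theorem im_unitFoot_sub_mul_conj_ne_zero {a b c : ℂ} (ha : ‖a‖ = 1) (hb : ‖b‖ = 1) (hc : ‖c‖ = 1)
    (hab : a ≠ b) (hbc : b ≠ c) (hca : c ≠ a) (hab' : a + b ≠ 0) (hbc' : b + c ≠ 0)
    (hca' : c + a ≠ 0) :
    ((unitFoot b c a - unitFoot a b c) * conj (unitFoot c a b - unitFoot a b c)).im ≠ 0 := by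
  have ha0 := ne_zero_of_norm_eq_one ha
  have hb0 := ne_zero_of_norm_eq_one hb
  have hc0 := ne_zero_of_norm_eq_one hc
  intro h
  have h1 := Complex.conj_eq_iff_im.2 h
  rw [unitFoot_sub_unitFoot hc ha, ← neg_sub (unitFoot a b c), unitFoot_sub_unitFoot ha hb] at h1
  simp only [map_mul, map_sub, map_neg, map_add, map_div₀, Complex.conj_ofNat, map_inv₀, inv_inv,
    conj_eq_inv_of_norm_eq_one ha, conj_eq_inv_of_norm_eq_one hb,
    conj_eq_inv_of_norm_eq_one hc] at h1
  field_simp at h1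
  have h2 : (a - b) * (a + b) * ((c - a) * (c + a)) * ((b - c) * (b + c)) = 0 := by
    linear_combination h1
  simp only [mul_eq_zero, sub_eq_zero, hab, hbc, hca, hab', hbc', hca', or_self] at h2

theorem add_ne_zero_of_vertexInner_pos {a b c : ℂ} (ha : ‖a‖ = 1) (hb : ‖b‖ = 1) (hc : ‖c‖ = 1)
    (h : 0 < vertexInner a b c) : b + c ≠ 0 := by
  intro h0
  have h1 := two_mul_vertexInner ha hb hc
  rw [h0, mul_zero, zero_div, mul_eq_zero] at h1
  exact h.ne' (by exact_mod_cast h1.resolve_left two_ne_zero)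

theorem fin_three_add (i : Fin 3) :
    i + 1 + 1 = i + 2 ∧ i + 1 + 2 = i ∧ i + 2 + 1 = i ∧ i + 2 + 2 = i + 1 := by
  decide +revert

namespace HasUnitCoords

variable {T : Affine.Triangle ℝ Plane} {O : Plane} {R : ℝ} {z : Fin 3 → ℂ}
  (h : HasUnitCoords T O R z)

include h

theorem exists_isOrthicTriangle (hT : T.AcuteAngled) : ∃ N, IsOrthicTriangle T N := by
  obtain ⟨v₀, v₁, v₂⟩ := h.acuteAngled_iff_vertexInner.1 hT
  have n₀ := h.norm_eq 0
  have n₁ := h.norm_eq 1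
  have n₂ := h.norm_eq 2
  let y : Fin 3 → ℂ := fun i => unitFoot (z i) (z (i + 1)) (z (i + 2))
  have e₀ : y 0 = unitFoot (z 0) (z 1) (z 2) := rfl
  have e₁ : y 1 = unitFoot (z 1) (z 2) (z 0) := rfl
  have e₂ : y 2 = unitFoot (z 2) (z 0) (z 1) := rfl
  have hy : ((y 1 - y 0) * conj (y 2 - y 0)).im ≠ 0 := by
    rw [e₀, e₁, e₂]
    exact im_unitFoot_sub_mul_conj_ne_zero n₀ n₁ n₂ (h.ne 0).1 (h.ne 0).2.1 (h.ne 0).2.2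
      (add_ne_zero_of_vertexInner_pos n₂ n₀ n₁ v₂) (add_ne_zero_of_vertexInner_pos n₀ n₁ n₂ v₀)
      (add_ne_zero_of_vertexInner_pos n₁ n₂ n₀ v₁)
  have hind := affineIndependent_chart (O := O) h.pos hy
  exact ⟨⟨_, hind⟩, fun i => (h.altitudeFoot_eq i).symm⟩

/-- The value does not depend on `i`, which characterizes `H` as the incenter and gives the inradius
at once. The touchpoint determines the absolute value and the positive barycentric weights determine
the sign. -/
theorem signedInfDist_orthic {N : Affine.Triangle ℝ Plane} (hN : IsOrthicTriangle T N)
    (hT : T.AcuteAngled) (i : Fin 3) :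
    N.signedInfDist i (chart O R (z 0 + z 1 + z 2)) =
      R * unitOrthicInradius (z 0) (z 1) (z 2) := by
  have n := h.norm_eq
  have hpts : ∀ i, N.points i = chart O R (unitFoot (z i) (z (i + 1)) (z (i + 2))) :=
    fun i => (hN i).trans (h.altitudeFoot_eq i)
  have hpts' : N.points = fun i => chart O R (unitFoot (z i) (z (i + 1)) (z (i + 2))) :=
    funext hpts
  have hsum : z 0 + z 1 + z 2 = z i + z (i + 1) + z (i + 2) := by
    rw [← sum_fin_three_cyclic z i, Fin.sum_univ_three]
  have hr : unitOrthicInradius (z 0) (z 1) (z 2) =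
      unitOrthicInradius (z i) (z (i + 1)) (z (i + 2)) := by
    rw [unitOrthicInradius, unitOrthicInradius, hsum]
  have hr0 : 0 ≤ unitOrthicInradius (z 0) (z 1) (z 2) := by
    have h1 := h.acuteAngled_iff.1 hT
    have h2 := norm_nonneg (z 0 + z 1 + z 2)
    unfold unitOrthicInradius
    nlinarith
  let w : Fin 3 → ℝ := fun i => orthicWeight (z i) (z (i + 1)) (z (i + 2))
  have hw : ∑ i, w i = 1 := by
    rw [Fin.sum_univ_three]
    exact orthicWeight_add (n 0) (n 1) (n 2) (h.ne 0).1 (h.ne 0).2.1 (h.ne 0).2.2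
  have hH : Finset.univ.affineCombination ℝ N.points w = chart O R (z 0 + z 1 + z 2) := by
    rw [hpts', affineCombination_chart _ _ hw, Fin.sum_univ_three]
    exact congrArg _ (orthicWeight_mul_unitFoot_add (n 0) (n 1) (n 2) (h.ne 0).1 (h.ne 0).2.1
      (h.ne 0).2.2)
  have hpos : 0 ≤ N.signedInfDist i (chart O R (z 0 + z 1 + z 2)) := by
    rw [← hH, Affine.Simplex.signedInfDist_affineCombination _ _ hw]
    exact mul_nonneg (orthicWeight_pos (h.ne i).1 (h.ne i).2.2 (h.vertexInner_pos hT i)).le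
      (norm_nonneg _)
  have hmem : chart O R (z 0 + z 1 + z 2) ∈ affineSpan ℝ (Set.range N.points) := by
    rw [affineSpan_range_points_eq_top]
    trivial
  obtain ⟨i₁, i₂, i₃, i₄⟩ := fin_three_add i
  rw [← abs_of_nonneg hpos, Affine.Simplex.abs_signedInfDist_eq_dist_of_mem_affineSpan_range _ hmem,
    hr, hsum, orthogonalProjectionSpan_chart h.pos hpts i
      (y := z i + z (i + 1) + z (i + 2) +
        unitOrthicInradius (z i) (z (i + 1)) (z (i + 2)) * z i), dist_chart h.pos,
    sub_add_cancel_left, norm_neg, norm_mul, n, mul_one, Complex.norm_real, Real.norm_eq_abs,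
    abs_of_nonneg (hr ▸ hr0)]
  · rw [i₁, i₂, i₃, i₄]
    exact exists_orthic_touchpoint_eq (n _) (n _) (n _) (h.ne i).2.1
      (add_ne_zero_of_vertexInner_pos (n _) (n _) (n _) (h.vertexInner_pos hT i))
  · rw [i₁, i₂, i₃, i₄]
    exact re_mul_conj_unitFoot_sub (n _) (n _) (n _) _

theorem incenter_orthic {N : Affine.Triangle ℝ Plane} (hN : IsOrthicTriangle T N)
    (hT : T.AcuteAngled) : N.incenter = T.orthocenter := by
  rw [h.orthocenter_eq, eq_comm, ← N.exists_forall_signedInfDist_eq_iff_eq_incenter]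
  · exact ⟨_, h.signedInfDist_orthic hN hT⟩
  · rw [affineSpan_range_points_eq_top]
    trivial

theorem inradius_orthic {N : Affine.Triangle ℝ Plane} (hN : IsOrthicTriangle T N)
    (hT : T.AcuteAngled) :
    N.inradius = R * ((1 - ‖z 0 + z 1 + z 2‖ ^ 2) / 4) := by
  rw [← N.signedInfDist_incenter 0, h.incenter_orthic hN hT, h.orthocenter_eq,
    h.signedInfDist_orthic hN hT, unitOrthicInradius]

theorem circumscribedBy_iff {E : Ellipse} {f g : ℂ} (hf : E.focus₁ = chart O R f)
    (hg : E.focus₂ = chart O R g) :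
    E.CircumscribedBy T ↔ IsogonalFoci f g (z 0) (z 1) (z 2) ∧
      4 * (E.semiMinorSq R : ℂ) = (1 - f * conj f) * (1 - g * conj g) := by
  have key : ∀ i j, i ≠ j → (E.IsTangentLine (affineSpan ℝ {T.points i, T.points j}) ↔
      ChordTangent f g (E.semiMinorSq R) (z i) (z j)) := by
    intro i j hij
    rw [h.points_eq, h.points_eq]
    exact Ellipse.isTangentLine_chart_iff h.pos hf hg (h.norm_eq i) (h.norm_eq j)
      (h.injective.ne hij)
  rw [← chordTangent_iff_isogonalFoci (h.norm_eq 0) (h.norm_eq 1) (h.norm_eq 2) (h.ne 0).1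
    (h.ne 0).2.1 (h.ne 0).2.2]
  constructor
  · intro hE
    exact ⟨(key 0 1 (by decide)).1 (hE 0 1 (by decide)),
      (key 1 2 (by decide)).1 (hE 1 2 (by decide)), (key 2 0 (by decide)).1 (hE 2 0 (by decide))⟩
  · rintro ⟨h₁, h₂, h₃⟩ i j hij
    rw [key i j hij]
    fin_cases i <;> fin_cases j
    · exact absurd rfl hij
    · exact h₁
    · exact h₃.symm
    · exact h₁.symm
    · exact absurd rfl hij
    · exact h₂
    · exact h₃
    · exact h₂.symm
    · exact absurd rfl hij

end HasUnitCoords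

/-! ### The Poncelet family -/

/-- In each case one of the two summands `f + g` and `conj f * conj g * (a * b * c)` vanishes, so
the norm is additive. -/
theorem IsogonalFoci.norm_sum {f g a b c : ℂ} (ha : ‖a‖ = 1) (hb : ‖b‖ = 1) (hc : ‖c‖ = 1)
    (h : IsogonalFoci f g a b c) (hfg : f + g = 0 ∨ f = 0 ∨ g = 0) :
    ‖a + b + c‖ = ‖f + g‖ + ‖f‖ * ‖g‖ := by
  unfold IsogonalFoci at h
  rw [h]
  rcases hfg with hfg | rfl | rfl
  · simp [hfg, ha, hb, hc]
  · simp
  · simp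

theorem norm_ne_one_of_mul_ne_zero {f g : ℂ} (h : (1 - f * conj f) * (1 - g * conj g) ≠ 0) :
    ‖f‖ ≠ 1 ∧ ‖g‖ ≠ 1 := by
  constructor <;> intro h1 <;> apply h <;> simp [Complex.mul_conj', h1]

theorem Ellipse.center_eq_chart {E : Ellipse} {O : Plane} {R : ℝ} {f g : ℂ}
    (hf : E.focus₁ = chart O R f) (hg : E.focus₂ = chart O R g) :
    E.center = chart O R ((f + g) / 2) := by
  rw [Ellipse.center, hf, hg, chart_midpoint]

theorem OrthicIncirclesCongruent.mono {F F' : Set (Affine.Triangle ℝ Plane)}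
    (h : OrthicIncirclesCongruent F') (hF : F ⊆ F') : OrthicIncirclesCongruent F :=
  fun T₁ h₁ T₂ h₂ => h T₁ (hF h₁) T₂ (hF h₂)

section family

variable {E : Ellipse} {T₀ : Affine.Triangle ℝ Plane} {f g : ℂ}

theorem exists_hasUnitCoords_of_mem_ponceletFamily {T : Affine.Triangle ℝ Plane}
    (hT : T ∈ E.ponceletFamily T₀) :
    ∃ z, HasUnitCoords T T₀.circumcenter T₀.circumradius z := by
  obtain ⟨z, hz⟩ := exists_hasUnitCoords T
  rw [Affine.Simplex.circumcenter, Affine.Simplex.circumradius, hT.1] at hz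
  exact ⟨z, hz⟩

variable (hacute : T₀.AcuteAngled) (hcirc : E.CircumscribedBy T₀)
  (hf : E.focus₁ = chart T₀.circumcenter T₀.circumradius f)
  (hg : E.focus₂ = chart T₀.circumcenter T₀.circumradius g)

include hf hg

theorem circumcenter_eq_iff :
    (T₀.circumcenter = E.center ∨ T₀.circumcenter = E.focus₁ ∨ T₀.circumcenter = E.focus₂) ↔
      f + g = 0 ∨ f = 0 ∨ g = 0 := by
  have key : ∀ x : ℂ, T₀.circumcenter = chart T₀.circumcenter T₀.circumradius x ↔ x = 0 := by
    intro x
    have h := (chart_injective (O := T₀.circumcenter) T₀.circumradius_pos).eq_iff (a := x) (b := 0)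
    rw [chart_zero] at h
    rw [eq_comm, h]
  rw [Ellipse.center_eq_chart hf hg, hf, hg, key, key, key]
  simp

include hacute hcirc

theorem norm_sum_eq_of_mem_ponceletFamily (hfg : f + g = 0 ∨ f = 0 ∨ g = 0)
    {T : Affine.Triangle ℝ Plane} (hT : T ∈ E.ponceletFamily T₀) {z : Fin 3 → ℂ}
    (hz : HasUnitCoords T T₀.circumcenter T₀.circumradius z) :
    ‖z 0 + z 1 + z 2‖ = ‖f + g‖ + ‖f‖ * ‖g‖ ∧ T.AcuteAngled := by
  have h := ((hz.circumscribedBy_iff hf hg).1 hT.2).1.norm_sum (hz.norm_eq 0) (hz.norm_eq 1)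
    (hz.norm_eq 2) hfg
  refine ⟨h, ?_⟩
  obtain ⟨z₀, hz₀⟩ := exists_hasUnitCoords T₀
  rw [hz.acuteAngled_iff, h, ← ((hz₀.circumscribedBy_iff hf hg).1 hcirc).1.norm_sum
    (hz₀.norm_eq 0) (hz₀.norm_eq 1) (hz₀.norm_eq 2) hfg]
  exact hz₀.acuteAngled_iff.1 hacute

theorem orthicIncirclesCongruent_ponceletFamily (hfg : f + g = 0 ∨ f = 0 ∨ g = 0) :
    OrthicIncirclesCongruent (E.ponceletFamily T₀) := by
  intro T₁ h₁ T₂ h₂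
  obtain ⟨z₁, hz₁⟩ := exists_hasUnitCoords_of_mem_ponceletFamily h₁
  obtain ⟨z₂, hz₂⟩ := exists_hasUnitCoords_of_mem_ponceletFamily h₂
  obtain ⟨e₁, a₁⟩ := norm_sum_eq_of_mem_ponceletFamily hacute hcirc hf hg hfg h₁ hz₁
  obtain ⟨e₂, a₂⟩ := norm_sum_eq_of_mem_ponceletFamily hacute hcirc hf hg hfg h₂ hz₂
  obtain ⟨N₁, hN₁⟩ := hz₁.exists_isOrthicTriangle a₁
  obtain ⟨N₂, hN₂⟩ := hz₂.exists_isOrthicTriangle a₂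
  refine ⟨N₁, N₂, hN₁, hN₂, ?_⟩
  rw [hz₁.inradius_orthic hN₁ a₁, hz₂.inradius_orthic hN₂ a₂, e₁, e₂]

theorem foci_of_orthicIncirclesCongruent_acute
    (hcong : OrthicIncirclesCongruent {T ∈ E.ponceletFamily T₀ | T.AcuteAngled}) :
    f + g = 0 ∨ f = 0 ∨ g = 0 := by
  by_contra! hcon
  obtain ⟨hfg, hf0, hg0⟩ := hcon
  obtain ⟨z₀, hz₀⟩ := exists_hasUnitCoords T₀
  have hR := T₀.circumradius_pos
  obtain ⟨hiso, hκ⟩ := (hz₀.circumscribedBy_iff hf hg).1 hcirc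
  -- A positive semi-minor axis keeps both foci off the circumcircle, as the closing-up construction
  -- needs.
  have hne : (1 - f * conj f) * (1 - g * conj g) ≠ 0 := by
    rw [← hκ]
    exact mul_ne_zero (by norm_num) (Complex.ofReal_ne_zero.2 (E.semiMinorSq_pos hR).ne')
  obtain ⟨hf1, hg1⟩ := norm_ne_one_of_mul_ne_zero hne
  obtain ⟨a, b, c, ha, hb, hc, hab, hbc, hca, hiso', hlt, hne'⟩ :=
    exists_isogonalFoci_norm_ne hf1 hg1 (hz₀.norm_eq 0) (hz₀.norm_eq 1) (hz₀.norm_eq 2)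
      (hz₀.ne 0).1 (hz₀.ne 0).2.1 (hz₀.ne 0).2.2 hiso (hz₀.acuteAngled_iff.1 hacute) hf0 hg0 hfg
  obtain ⟨T, hz⟩ := exists_triangle_hasUnitCoords (O := T₀.circumcenter) hR (z := ![a, b, c])
    (by simp [Fin.forall_fin_succ, ha, hb, hc])
    (by
      intro i j hij
      fin_cases i <;> fin_cases j <;> simp_all [eq_comm])
  have hTa : T.AcuteAngled := hz.acuteAngled_iff.2 hlt
  have hT : T ∈ E.ponceletFamily T₀ :=
    ⟨hz.circumsphere_eq.trans hz₀.circumsphere_eq.symm,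
      (hz.circumscribedBy_iff hf hg).2 ⟨hiso', hκ⟩⟩
  obtain ⟨N, N₀, hN, hN₀, hr⟩ := hcong T ⟨hT, hTa⟩ T₀ ⟨⟨rfl, hcirc⟩, hacute⟩
  rw [hz.inradius_orthic hN hTa, hz₀.inradius_orthic hN₀ hacute] at hr
  have hr' := mul_left_cancel₀ hR.ne' hr
  apply hne'
  refine (sq_eq_sq₀ (norm_nonneg _) (norm_nonneg _)).1 ?_
  change (1 - ‖a + b + c‖ ^ 2) / 4 = _ at hr'
  linarith

theorem exists_insphere_eq_of_circumcenter_eq_focus {x : ℂ} (hx : (f = 0 ∧ g = x) ∨ (g = 0 ∧ f = x))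
    {T : Affine.Triangle ℝ Plane} (hT : T ∈ E.ponceletFamily T₀) :
    T.orthocenter = chart T₀.circumcenter T₀.circumradius x ∧
      ∃ N, IsOrthicTriangle T N ∧ N.insphere =
        ⟨chart T₀.circumcenter T₀.circumradius x, T₀.circumradius * ((1 - ‖x‖ ^ 2) / 4)⟩ := by
  obtain ⟨z, hz⟩ := exists_hasUnitCoords_of_mem_ponceletFamily hT
  obtain ⟨-, hTa⟩ := norm_sum_eq_of_mem_ponceletFamily hacute hcirc hf hg (by tauto) hT hz
  have hsum : z 0 + z 1 + z 2 = x := by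
    have h := ((hz.circumscribedBy_iff hf hg).1 hT.2).1
    unfold IsogonalFoci at h
    rw [h]
    rcases hx with ⟨rfl, rfl⟩ | ⟨rfl, rfl⟩ <;> simp
  have hH : T.orthocenter = chart T₀.circumcenter T₀.circumradius x := by
    rw [hz.orthocenter_eq, hsum]
  obtain ⟨N, hN⟩ := hz.exists_isOrthicTriangle hTa
  refine ⟨hH, N, hN, ?_⟩
  ext1
  · exact (hz.incenter_orthic hN hTa).trans hH
  · exact (hz.inradius_orthic hN hTa).trans (by rw [hsum])

end family

theorem mul_one_sub_sq_div_four {R n : ℝ} (hR : 0 < R) :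
    R * ((1 - n ^ 2) / 4) = (R ^ 2 - (R * n) ^ 2) / (4 * R) := by
  field_simp

theorem theorem5p3 (E : Ellipse) (T₀ : Affine.Triangle ℝ Plane)
    (hacute : T₀.AcuteAngled) (hcirc : E.CircumscribedBy T₀) :
    -- the characterization, for the whole family
    (OrthicIncirclesCongruent (E.ponceletFamily T₀) ↔
      (T₀.circumcenter = E.center ∨
        T₀.circumcenter = E.focus₁ ∨ T₀.circumcenter = E.focus₂)) ∧
    -- the characterization, for the acute triangles of the family
    (OrthicIncirclesCongruent {T ∈ E.ponceletFamily T₀ | T.AcuteAngled} ↔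
      (T₀.circumcenter = E.center ∨
        T₀.circumcenter = E.focus₁ ∨ T₀.circumcenter = E.focus₂)) ∧
    -- the inradius of the orthic triangle
    (∀ T ∈ E.ponceletFamily T₀, T.AcuteAngled →
      ∃ N : Affine.Triangle ℝ Plane, IsOrthicTriangle T N ∧
        N.inradius = (T.circumradius ^ 2 - dist T.circumcenter T.orthocenter ^ 2) /
          (4 * T.circumradius)) ∧
    -- if the circumcenter is the focus `F`, and `F'` is the other focus, the incircle is fixed
    (∀ F F' : Plane,
      (F = E.focus₁ ∧ F' = E.focus₂) ∨ (F = E.focus₂ ∧ F' = E.focus₁) →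
      T₀.circumcenter = F →
      ∃ S : EuclideanGeometry.Sphere Plane,
        S.center = F' ∧
        S.radius = (T₀.circumradius ^ 2 - dist F F' ^ 2) / (4 * T₀.circumradius) ∧
        ∀ T ∈ E.ponceletFamily T₀, T.orthocenter = F' ∧
          ∃ N : Affine.Triangle ℝ Plane, IsOrthicTriangle T N ∧ N.insphere = S) := by
  obtain ⟨f, hf'⟩ := chart_surjective (O := T₀.circumcenter) T₀.circumradius_pos E.focus₁
  obtain ⟨g, hg'⟩ := chart_surjective (O := T₀.circumcenter) T₀.circumradius_pos E.focus₂
  have hf := hf'.symm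
  have hg := hg'.symm
  rw [circumcenter_eq_iff hf hg]
  refine ⟨⟨fun h => ?_, orthicIncirclesCongruent_ponceletFamily hacute hcirc hf hg⟩,
    ⟨foci_of_orthicIncirclesCongruent_acute hacute hcirc hf hg, fun h => ?_⟩, ?_, ?_⟩
  -- Congruence over the whole family restricts to its acute members, where the converse is proved.
  · exact foci_of_orthicIncirclesCongruent_acute hacute hcirc hf hg (h.mono fun T hT => hT.1)
  · exact (orthicIncirclesCongruent_ponceletFamily hacute hcirc hf hg h).mono fun T hT => hT.1
  · intro T _ hTa
    obtain ⟨z, hz⟩ := exists_hasUnitCoords T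
    obtain ⟨N, hN⟩ := hz.exists_isOrthicTriangle hTa
    refine ⟨N, hN, ?_⟩
    rw [hz.inradius_orthic hN hTa, mul_one_sub_sq_div_four hz.pos, hz.orthocenter_eq, dist_comm,
      dist_chart_origin hz.pos]
  · intro F F' hFF' hO
    obtain ⟨x, hx⟩ := chart_surjective (O := T₀.circumcenter) T₀.circumradius_pos F'
    have hinj := chart_injective (O := T₀.circumcenter) T₀.circumradius_pos
    have hF : F = chart T₀.circumcenter T₀.circumradius 0 := by rw [chart_zero, hO]
    have hx' : (f = 0 ∧ g = x) ∨ (g = 0 ∧ f = x) := by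
      rcases hFF' with ⟨h₁, h₂⟩ | ⟨h₁, h₂⟩
      · exact Or.inl ⟨hinj (hf'.trans (h₁.symm.trans hF)), hinj (hg'.trans (h₂.symm.trans hx.symm))⟩
      · exact Or.inr ⟨hinj (hg'.trans (h₁.symm.trans hF)), hinj (hf'.trans (h₂.symm.trans hx.symm))⟩
    refine ⟨⟨F', T₀.circumradius * ((1 - ‖x‖ ^ 2) / 4)⟩, rfl, ?_, fun T hT => ?_⟩
    · rw [mul_one_sub_sq_div_four T₀.circumradius_pos, ← hx, ← hO, dist_comm,
        dist_chart_origin T₀.circumradius_pos]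
    · rw [← hx]
      exact exists_insphere_eq_of_circumcenter_eq_focus hacute hcirc hf hg hx' hT
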